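/- Let $K$ be a field, let $s\ge 1$ and $n\ge 2$ be integers, and let $\Delta$ be the cyclic quiver with $s$ vertices $1,\dots,s$ and $s$ arrows $x_i : i\to i+1$ (indices modulo $s$). For $m\ge 1$ let $R_\Delta^m$ be the two-sided ideal of the path algebra $K\Delta$ generated by the paths of length $m$, and put $A=K\Delta/R_\Delta^n$. Let $D(A)=\operatorname{Hom}_K(A,K)$ with its standard $A$-bimodule structure $(a\varphi)(x)=\varphi(xa)$, $(\varphi a)(x)=\varphi(ax)$, and let $\alpha:A\times A\to D(A)$ be a Hochschild $2$-cocycle, i.e. a $K$-bilinear map with $$a\,\alpha(b,c)-\alpha(ab,c)+\alpha(a,bc)-\alpha(a,b)\,c=0\qquad (a,b,c\in A).$$ Let $T_\alpha(A)$ be the Hochschild extension algebra: the $K$-vector space $A\oplus D(A)$ with multiplication $(a,x)(b,y)=(ab,\;ay+xb+\alpha(a,b))$ and identity $(1,-\alpha(1,1))$. If the ordinary quiver of $T_\alpha(A)$ is $\Delta$, then $T_\alpha(A)$ is isomorphic to $K\Delta/R_\Delta^{2n}$ as a $K$-algebra, and $T_\alpha(A)$ is a symmetric algebra (that is, $T_\alpha(A)\cong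 \operatorname{Hom}_K(T_\alpha(A),K)$ as $T_\alpha(A)$-bimodules). Here the ordinary quiver of a finite dimensional basic $K$-algebra $T$ with Jacobson radical $J$ is the quiver whose vertices correspond to a complete set $e_1,\dots,e_l$ of primitive orthogonal idempotents of $T$, with $\dim_K\big(e_iJe_j/e_iJ^2e_j\big)$ arrows from $i$ to $j$. -/

import Mathlib

open Quiver

noncomputable section

/-! ### Path algebras and truncated quiver algebras -/

section PathAlgebra

universe u v w

/-- The path algebra `KΔ` of a quiver `Δ` with vertex set `V`: the `K`-vector space whose basis
is the set of all paths of `Δ` (including the trivial path `e_i` at each vertex `i`). -/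
def PathAlgebra (K : Type w) [Field K] (V : Type u) [Quiver.{v} V] : Type (max u v w) :=
  (Σ i j : V, Path i j) →₀ K

variable {K : Type w} [Field K] {V : Type u} [Quiver.{v} V]

namespace PathAlgebra

instance : AddCommGroup (PathAlgebra K V) :=
  inferInstanceAs (AddCommGroup ((Σ i j : V, Path i j) →₀ K))

instance : Module K (PathAlgebra K V) :=
  inferInstanceAs (Module K ((Σ i j : V, Path i j) →₀ K))

variable (K V) in
/-- The basis of `KΔ` consisting of all paths. -/
def basis : Module.Basis (Σ i j : V, Path i j) K (PathAlgebra K V) :=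
  ⟨LinearEquiv.refl K ((Σ i j : V, Path i j) →₀ K)⟩

variable (K) in
/-- The basis element of `KΔ` given by a path. -/
def ofPath {i j : V} (p : Path i j) : PathAlgebra K V :=
  basis K V ⟨i, j, p⟩

open Classical in
variable (K) in
/-- The product of two paths in `KΔ`: the concatenation `pq` (first `p`, then `q`) if `p` ends
where `q` starts, and `0` otherwise. -/
def pathMul (p q : Σ i j : V, Path i j) : PathAlgebra K V :=
  if h : p.2.1 = q.1 then ofPath K (p.2.2.comp (q.2.2.cast h.symm rfl)) else 0

variable (K V) in
/-- The bilinear extension of the product of paths. -/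
def mulHom : PathAlgebra K V →ₗ[K] PathAlgebra K V →ₗ[K] PathAlgebra K V :=
  (basis K V).constr K fun p => (basis K V).constr K fun q => pathMul K p q

instance : Mul (PathAlgebra K V) := ⟨fun x y => mulHom K V x y⟩

/-- The identity of `KΔ` is the sum of the trivial paths. -/
instance [Fintype V] : One (PathAlgebra K V) := ⟨∑ i : V, ofPath K (Path.nil : Path i i)⟩

theorem mul_def (x y : PathAlgebra K V) : x * y = mulHom K V x y := rfl

theorem one_def [Fintype V] :
    (1 : PathAlgebra K V) = ∑ i : V, ofPath K (Path.nil : Path i i) := rfl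

theorem mulHom_ofPath {i j k l : V} (p : Path i j) (q : Path k l) :
    mulHom K V (ofPath K p) (ofPath K q) = pathMul K ⟨i, j, p⟩ ⟨k, l, q⟩ := by
  simp [mulHom, ofPath, Module.Basis.constr_basis]

theorem ofPath_mul_ofPath {i j k : V} (p : Path i j) (q : Path j k) :
    ofPath K p * ofPath K q = ofPath K (p.comp q) := by
  rw [mul_def, mulHom_ofPath]
  simp [pathMul]

theorem ofPath_mul_ofPath_of_ne {i j k l : V} (p : Path i j) (q : Path k l) (h : j ≠ k) :
    ofPath K p * ofPath K q = 0 := by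
  rw [mul_def, mulHom_ofPath]
  simp [pathMul, h]

theorem hom_ext {M : Type*} [AddCommGroup M] [Module K M] {f g : PathAlgebra K V →ₗ[K] M}
    (h : ∀ (i j : V) (p : Path i j), f (ofPath K p) = g (ofPath K p)) : f = g :=
  (basis K V).ext fun ⟨i, j, p⟩ => h i j p

theorem ofPath_assoc {i j k l m o : V} (p : Path i j) (q : Path k l) (r : Path m o) :
    ofPath K p * ofPath K q * ofPath K r = ofPath K p * (ofPath K q * ofPath K r) := by
  have zl : ∀ x : PathAlgebra K V, 0 * x = 0 := fun x => by simp [mul_def]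
  have zr : ∀ x : PathAlgebra K V, x * 0 = 0 := fun x => by simp [mul_def]
  by_cases h : j = k
  · subst h
    rw [ofPath_mul_ofPath]
    by_cases h' : l = m
    · subst h'
      simp only [ofPath_mul_ofPath, Path.comp_assoc]
    · rw [ofPath_mul_ofPath_of_ne _ _ h', ofPath_mul_ofPath_of_ne _ _ h', zr]
  · rw [ofPath_mul_ofPath_of_ne _ _ h, zl]
    by_cases h' : l = m
    · subst h'
      rw [ofPath_mul_ofPath, ofPath_mul_ofPath_of_ne _ _ h]
    · rw [ofPath_mul_ofPath_of_ne _ _ h', zr]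

theorem mulHom_assoc (x y z : PathAlgebra K V) :
    mulHom K V (mulHom K V x y) z = mulHom K V x (mulHom K V y z) := by
  have hz : ∀ (i j k l : V) (p : Path i j) (q : Path k l),
      mulHom K V (mulHom K V (ofPath K p) (ofPath K q)) =
        mulHom K V (ofPath K p) ∘ₗ mulHom K V (ofPath K q) := fun i j k l p q =>
    hom_ext fun m o r => ofPath_assoc p q r
  have hy : ∀ (i j : V) (p : Path i j) (z : PathAlgebra K V),
      (mulHom K V).flip z ∘ₗ mulHom K V (ofPath K p) =
        mulHom K V (ofPath K p) ∘ₗ (mulHom K V).flip z := fun i j p z =>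
    hom_ext fun k l q => LinearMap.congr_fun (hz i j k l p q) z
  have hx : (mulHom K V).flip z ∘ₗ (mulHom K V).flip y =
      (mulHom K V).flip (mulHom K V y z) :=
    hom_ext fun i j p => LinearMap.congr_fun (hy i j p z) y
  exact LinearMap.congr_fun hx x

theorem one_mulHom [Fintype V] (x : PathAlgebra K V) : mulHom K V 1 x = x := by
  classical
  have h : mulHom K V 1 = LinearMap.id := hom_ext fun i j p => by
    rw [one_def, map_sum, LinearMap.sum_apply, Finset.sum_eq_single i]
    · exact (ofPath_mul_ofPath _ _).trans (by simp)
    · exact fun k _ hk => ofPath_mul_ofPath_of_ne _ _ hk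
    · simp
  exact LinearMap.congr_fun h x

theorem mulHom_one [Fintype V] (x : PathAlgebra K V) : mulHom K V x 1 = x := by
  classical
  have h : (mulHom K V).flip 1 = LinearMap.id := hom_ext fun i j p => by
    rw [LinearMap.flip_apply, one_def, map_sum, Finset.sum_eq_single j]
    · exact (ofPath_mul_ofPath _ _).trans (by simp)
    · exact fun k _ hk => ofPath_mul_ofPath_of_ne _ _ hk.symm
    · simp
  exact LinearMap.congr_fun h x

instance [Fintype V] : Ring (PathAlgebra K V) where
  left_distrib x y z := map_add (mulHom K V x) y z
  right_distrib x y z := LinearMap.map_add₂ (mulHom K V) x y z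
  zero_mul x := LinearMap.map_zero₂ (mulHom K V) x
  mul_zero x := map_zero (mulHom K V x)
  mul_assoc := mulHom_assoc
  one_mul := one_mulHom
  mul_one := mulHom_one
  zsmul := fun n x => n • x
  zsmul_zero' := SubNegMonoid.zsmul_zero'
  zsmul_succ' := SubNegMonoid.zsmul_succ'
  zsmul_neg' := SubNegMonoid.zsmul_neg'
  neg_add_cancel := neg_add_cancel
  sub_eq_add_neg := sub_eq_add_neg
  nsmul := fun n x => n • x
  nsmul_zero := AddMonoid.nsmul_zero
  nsmul_succ := AddMonoid.nsmul_succ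

instance [Fintype V] : Algebra K (PathAlgebra K V) :=
  Algebra.ofModule (fun r x y => LinearMap.map_smul₂ (mulHom K V) r x y)
    (fun r x y => map_smul (mulHom K V x) r y)

end PathAlgebra

variable (K V) in
/-- `R_Δ^n`: the two-sided ideal of `KΔ` generated by the paths of length `n`. -/
def arrowIdealPow [Fintype V] (n : ℕ) : TwoSidedIdeal (PathAlgebra K V) :=
  TwoSidedIdeal.span {x | ∃ (i j : V) (p : Path i j), p.length = n ∧ x = PathAlgebra.ofPath K p}

variable (K V) in
/-- The truncated quiver algebra `KΔ/R_Δ^n`. -/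
abbrev TruncatedQuiverAlgebra [Fintype V] (n : ℕ) : Type (max u v w) :=
  (arrowIdealPow K V n).ringCon.Quotient

end PathAlgebra

/-! ### The cyclic quiver -/

/-- The vertex set of the cyclic quiver with `s` vertices (for `s ≥ 1`): the integers mod `s`. -/
def CyclicQuiver (s : ℕ) : Type := ZMod s

/-- The vertex `i + 1` following the vertex `i` on the cycle. -/
def CyclicQuiver.succ {s : ℕ} (i : CyclicQuiver s) : CyclicQuiver s :=
  let i' : ZMod s := i
  i' + 1

/-- The cyclic quiver has exactly one arrow `i ⟶ i + 1` for each vertex `i`, and no others. -/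
instance (s : ℕ) : Quiver.{0} (CyclicQuiver s) where
  Hom i j := PLift (CyclicQuiver.succ i = j)

instance (s : ℕ) [NeZero s] : Fintype (CyclicQuiver s) := inferInstanceAs (Fintype (ZMod s))

/-! ### The dual bimodule, 2-cocycles and Hochschild extension algebras -/

section Hochschild

variable {K : Type*} [Field K] {A : Type*} [Ring A] [Algebra K A]

/-- The left action of `A` on `D(A) = Hom_K(A, K)`: `(a φ)(x) = φ (x a)`. -/
def dualLeft (a : A) : Module.Dual K A →ₗ[K] Module.Dual K A :=
  (LinearMap.mulRight K a).dualMap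

/-- The right action of `A` on `D(A) = Hom_K(A, K)`: `(φ a)(x) = φ (a x)`. -/
def dualRight (a : A) : Module.Dual K A →ₗ[K] Module.Dual K A :=
  (LinearMap.mulLeft K a).dualMap

@[simp] theorem dualLeft_apply (a x : A) (φ : Module.Dual K A) :
    dualLeft a φ x = φ (x * a) := rfl

@[simp] theorem dualRight_apply (a x : A) (φ : Module.Dual K A) :
    dualRight a φ x = φ (a * x) := rfl

variable (K A) in
/-- A Hochschild 2-cocycle `α : A × A → D(A)`: a `K`-bilinear map with
`a α(b, c) - α(ab, c) + α(a, bc) - α(a, b) c = 0`. -/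
structure TwoCocycle where
  /-- the underlying bilinear map -/
  toBilin : A →ₗ[K] A →ₗ[K] Module.Dual K A
  cocycle : ∀ a b c : A, dualLeft a (toBilin b c) - toBilin (a * b) c + toBilin a (b * c)
    - dualRight c (toBilin a b) = 0

/-- The underlying space `A ⊕ D(A)` of the Hochschild extension algebra `T_α(A)`. -/
def HochschildExtension (_α : TwoCocycle K A) : Type _ := A × Module.Dual K A

namespace HochschildExtension

variable (α : TwoCocycle K A)

instance : AddCommGroup (HochschildExtension α) :=
  inferInstanceAs (AddCommGroup (A × Module.Dual K A))

instance : Module K (HochschildExtension α) :=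
  inferInstanceAs (Module K (A × Module.Dual K A))

/-- `(a, x)(b, y) = (ab, ay + xb + α(a, b))`. -/
instance : Mul (HochschildExtension α) :=
  ⟨fun p q => ((p.1 * q.1, dualLeft p.1 q.2 + dualRight q.1 p.2 + α.toBilin p.1 q.1) :
    A × Module.Dual K A)⟩

/-- The identity is `(1, -α(1, 1))`. -/
instance : One (HochschildExtension α) :=
  ⟨((1, -α.toBilin 1 1) : A × Module.Dual K A)⟩

variable {α}

@[ext] theorem ext {p q : HochschildExtension α} (h₁ : p.1 = q.1) (h₂ : ∀ x, p.2 x = q.2 x) :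
    p = q :=
  Prod.ext h₁ (LinearMap.ext h₂)

@[simp] theorem mul_fst (p q : HochschildExtension α) : (p * q).1 = p.1 * q.1 := rfl
@[simp] theorem mul_snd (p q : HochschildExtension α) :
    (p * q).2 = dualLeft p.1 q.2 + dualRight q.1 p.2 + α.toBilin p.1 q.1 := rfl
@[simp] theorem one_fst : (1 : HochschildExtension α).1 = 1 := rfl
@[simp] theorem one_snd : (1 : HochschildExtension α).2 = -α.toBilin 1 1 := rfl
@[simp] theorem add_fst (p q : HochschildExtension α) : (p + q).1 = p.1 + q.1 := rfl
@[simp] theorem add_snd (p q : HochschildExtension α) : (p + q).2 = p.2 + q.2 := rfl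
@[simp] theorem zero_fst : (0 : HochschildExtension α).1 = 0 := rfl
@[simp] theorem zero_snd : (0 : HochschildExtension α).2 = 0 := rfl
@[simp] theorem smul_fst (r : K) (p : HochschildExtension α) : (r • p).1 = r • p.1 := rfl
@[simp] theorem smul_snd (r : K) (p : HochschildExtension α) : (r • p).2 = r • p.2 := rfl

theorem cocycle_apply (a b c x : A) :
    α.toBilin b c (x * a) - α.toBilin (a * b) c x + α.toBilin a (b * c) x
      - α.toBilin a b (c * x) = 0 := by
  simpa using LinearMap.congr_fun (α.cocycle a b c) x

instance : Ring (HochschildExtension α) where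
  left_distrib p q r := by ext <;> simp [mul_add, add_mul]; abel
  right_distrib p q r := by ext <;> simp [mul_add, add_mul]; abel
  zero_mul p := by ext <;> simp
  mul_zero p := by ext <;> simp
  mul_assoc p q r := by
    ext x
    · simp [mul_assoc]
    · have h := cocycle_apply (α := α) p.1 q.1 r.1 x
      simp only [mul_snd, mul_fst, LinearMap.add_apply, dualLeft_apply, dualRight_apply,
        map_add, mul_assoc] at h ⊢
      linear_combination -h
  one_mul p := by
    ext x
    · simp
    · have h := cocycle_apply (α := α) 1 1 p.1 x
      simp at h ⊢
      linear_combination h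
  mul_one p := by
    ext x
    · simp
    · have h := cocycle_apply (α := α) p.1 1 1 x
      simp at h ⊢
      linear_combination -h
  zsmul := fun n x => n • x
  zsmul_zero' := SubNegMonoid.zsmul_zero'
  zsmul_succ' := SubNegMonoid.zsmul_succ'
  zsmul_neg' := SubNegMonoid.zsmul_neg'
  neg_add_cancel := neg_add_cancel
  sub_eq_add_neg := sub_eq_add_neg
  nsmul := fun n x => n • x
  nsmul_zero := AddMonoid.nsmul_zero
  nsmul_succ := AddMonoid.nsmul_succ

instance : Algebra K (HochschildExtension α) :=
  Algebra.ofModule (fun r p q => by ext <;> simp) (fun r p q => by ext <;> simp)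

end HochschildExtension

variable (K A) in
/-- An algebra is symmetric if it is isomorphic to its dual `D(A)` as an `A`-bimodule
(the existence of such an isomorphism forces `A` to be finite dimensional). -/
def IsSymmAlgebra : Prop :=
  ∃ f : A ≃ₗ[K] Module.Dual K A,
    ∀ a x : A, f (a * x) = dualLeft a (f x) ∧ f (x * a) = dualRight a (f x)

end Hochschild

/-! ### The ordinary quiver -/

/-- A primitive idempotent: a nonzero idempotent that is not the sum of two nonzero orthogonal
idempotents. -/
def IsPrimitiveIdempotent {T : Type*} [Ring T] (e : T) : Prop :=
  IsIdempotentElem e ∧ e ≠ 0 ∧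
    ∀ f g : T, IsIdempotentElem f → IsIdempotentElem g → f * g = 0 → g * f = 0 → e = f + g →
      f = 0 ∨ g = 0

section OrdinaryQuiver

universe v

variable (K : Type*) [Field K] {T : Type*} [Ring T] [Algebra K T]

/-- The subspace `e I f` of `T`, for a left ideal `I` of `T` and `e f : T`. -/
def corner (e f : T) (I : Ideal T) : Submodule K T :=
  (I.restrictScalars K).map (LinearMap.mulLeft K e ∘ₗ LinearMap.mulRight K f)

variable (T)

/-- The quiver with vertex set `V` is the ordinary quiver of the basic algebra `T`, with Jacobson
radical `J`: its vertices correspond to a complete set `(e_i)` of primitive orthogonal idempotents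
of `T`, with `T e_i ≇ T e_j` for `i ≠ j` (`T` is basic), and for all `i`, `j` its arrows from `i`
to `j` correspond to a basis of `e_i J e_j / e_i J² e_j`. -/
def IsOrdinaryQuiver (V : Type*) [Fintype V] [Quiver.{v} V] : Prop :=
  ∃ e : V → T, CompleteOrthogonalIdempotents e ∧ (∀ i, IsPrimitiveIdempotent (e i)) ∧
    (∀ i j, i ≠ j → IsEmpty (Ideal.span {e i} ≃ₗ[T] Ideal.span {e j})) ∧
    ∀ i j, Nonempty (Module.Basis (i ⟶ j) K
      (corner K (e i) (e j) (Ring.jacobson T) ⧸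
        (corner K (e i) (e j) (Ring.jacobson T * Ring.jacobson T)).submoduleOf
          (corner K (e i) (e j) (Ring.jacobson T))))

end OrdinaryQuiver

end

/-! Write T for the extension and J for its radical. The maps T → A → K^V, the second one killing
all arrows, have nilpotent kernel, because the summand D(A) of T squares to zero. As K^V is
semisimple, this kernel is J.

Lifting the bases of e_i J e_j / e_i J² e_j gives an algebra map φ : KΔ → T. It is onto: the images
of the e_i in K^V are as many nonzero orthogonal idempotents as the dimension, so they span it, and
J is nilpotent (`exists_surjective_algHom_of_ordinary`). Arrows go into J, so a path of length n has
no A-component, and a path of length 2n is a product of two elements of D(A), hence 0. Thus φ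
factors through KΔ/R^{2n}, and since both sides have dimension 2ns it induces an isomorphism. This
gives the first claim.

For symmetry, a path p of length 2n - 1 has nonzero image, which is a functional f in D(A).
Multiplying p by a path q on the left or on the right computes the same value of f. If p were not a
cycle, one of these products would always vanish, forcing f = 0 (`eq_of_ofPath_ne_zero`). Hence s
divides 2n - 1. The sum of the coefficients of the paths of length 2n - 1 is then a nondegenerate
trace form on KΔ/R^{2n} (`isSymmAlgebra_truncated`). -/

noncomputable section

/-! ### Universal property of the path algebra -/

namespace PathAlgebra

universe u v w

variable {K : Type w} [Field K] {V : Type u} [Quiver.{v} V]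

theorem basis_apply {i j : V} (p : Path i j) : basis K V ⟨i, j, p⟩ = ofPath K p := rfl

section Lift

variable {T : Type*} [Ring T] [Algebra K T]

/-- The product in `T` of the values of the arrows of a path. -/
def evalPath (e : V → T) (X : ∀ i j : V, (i ⟶ j) → T) {i : V} : ∀ {j : V}, Path i j → T
  | _, .nil => e i
  | _, .cons p a => evalPath e X p * X _ _ a

variable {e : V → T} {X : ∀ i j : V, (i ⟶ j) → T}

theorem evalPath_mul_idem (he : ∀ i, e i * e i = e i) (hr : ∀ i j a, X i j a * e j = X i j a)
    {i j : V} (p : Path i j) : evalPath e X p * e j = evalPath e X p := by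
  cases p with
  | nil => exact he i
  | cons p a => rw [evalPath, mul_assoc, hr]

theorem idem_mul_evalPath (he : ∀ i, e i * e i = e i) {i j : V} (p : Path i j) :
    e i * evalPath e X p = evalPath e X p := by
  induction p with
  | nil => exact he i
  | cons p a ih => rw [evalPath, ← mul_assoc, ih]

theorem evalPath_comp (he : ∀ i, e i * e i = e i) (hr : ∀ i j a, X i j a * e j = X i j a)
    {i j k : V} (p : Path i j) (q : Path j k) :
    evalPath e X (p.comp q) = evalPath e X p * evalPath e X q := by
  induction q with
  | nil => exact (evalPath_mul_idem he hr p).symm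
  | cons q a ih => rw [Path.comp_cons, evalPath, ih, evalPath, mul_assoc]

variable [Fintype V]

/-- The universal property of the path algebra. -/
def lift (he : CompleteOrthogonalIdempotents e) (hr : ∀ i j a, X i j a * e j = X i j a) :
    PathAlgebra K V →ₐ[K] T :=
  AlgHom.ofLinearMap ((basis K V).constr K fun P => evalPath e X P.2.2)
    (by
      rw [one_def, map_sum, ← he.complete]
      exact Finset.sum_congr rfl fun i _ => (basis K V).constr_basis K _ _)
    (by
      set φ := (basis K V).constr K fun P => evalPath e X P.2.2 with hφ
      have hb : ∀ {i j : V} (p : Path i j), φ (ofPath K p) = evalPath e X p := fun p =>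
        (basis K V).constr_basis K _ _
      have h : (LinearMap.mul K (PathAlgebra K V)).compr₂ φ =
          (LinearMap.mul K T).compl₁₂ φ φ := by
        refine hom_ext fun i j p => hom_ext fun k l q => ?_
        simp only [LinearMap.compr₂_apply, LinearMap.mul_apply', LinearMap.compl₁₂_apply, hb]
        by_cases hjk : j = k
        · subst hjk
          rw [ofPath_mul_ofPath, hb, evalPath_comp he.idem hr]
        -- Insert `e j` after the first factor and `e k` before the second; orthogonality kills the
        -- product.
        · rw [ofPath_mul_ofPath_of_ne _ _ hjk, map_zero,
            ← evalPath_mul_idem he.idem hr p, ← idem_mul_evalPath he.idem q, mul_assoc,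
            ← mul_assoc (e j), he.ortho hjk, zero_mul, mul_zero]
      exact fun x y => LinearMap.congr_fun₂ h x y)

theorem lift_ofPath (he : CompleteOrthogonalIdempotents e)
    (hr : ∀ i j a, X i j a * e j = X i j a) {i j : V} (p : Path i j) : lift (K := K) he hr (ofPath K p) = evalPath e X p :=
  (basis K V).constr_basis K _ _

end Lift

/-! ### Filtration of the path algebra by length -/

variable (K V) in
/-- The subspace of `KΔ` spanned by the paths of length at least `m`. -/
def lengthGE (m : ℕ) : Submodule K (PathAlgebra K V) :=
  Submodule.span K (basis K V '' {P | m ≤ P.2.2.length})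

theorem ofPath_mem_lengthGE {m : ℕ} {i j : V} (p : Path i j) (h : m ≤ p.length) :
    ofPath K p ∈ lengthGE K V m :=
  Submodule.subset_span ⟨⟨i, j, p⟩, h, rfl⟩

theorem lengthGE_le {m : ℕ} {M : Submodule K (PathAlgebra K V)}
    (h : ∀ (i j : V) (p : Path i j), m ≤ p.length → ofPath K p ∈ M) : lengthGE K V m ≤ M := by
  rw [lengthGE, Submodule.span_le]
  rintro _ ⟨⟨i, j, p⟩, hp, rfl⟩
  exact h i j p hp

theorem lengthGE_zero : lengthGE K V 0 = ⊤ := by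
  simp [lengthGE, (basis K V).span_eq]

theorem mem_lengthGE_iff {m : ℕ} {x : PathAlgebra K V} :
    x ∈ lengthGE K V m ↔
      ∀ P : Σ i j : V, Path i j, P.2.2.length < m → (basis K V).repr x P = 0 := by
  rw [lengthGE, Module.Basis.mem_span_image]
  constructor
  · intro h P hP
    by_contra hne
    exact absurd (h (Finsupp.mem_support_iff.2 hne)) (by simpa using hP)
  · intro h P hP
    by_contra hne
    exact Finsupp.mem_support_iff.1 hP (h P (by simpa using hne))

variable [Fintype V]

theorem mul_mem_lengthGE {a b : ℕ} {x y : PathAlgebra K V} (hx : x ∈ lengthGE K V a)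
    (hy : y ∈ lengthGE K V b) : x * y ∈ lengthGE K V (a + b) := by
  refine lengthGE_le (M := (lengthGE K V (a + b)).comap (LinearMap.mulRight K y))
    (fun i j p hp => ?_) hx
  refine lengthGE_le (M := (lengthGE K V (a + b)).comap (LinearMap.mulLeft K (ofPath K p)))
    (fun k l q hq => ?_) hy
  change ofPath K p * ofPath K q ∈ lengthGE K V (a + b)
  by_cases h : j = k
  · subst h
    rw [ofPath_mul_ofPath]
    exact ofPath_mem_lengthGE _ (by rw [Path.length_comp]; omega)
  · rw [ofPath_mul_ofPath_of_ne _ _ h]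
    exact zero_mem _

omit [Fintype V] in
/-- Every path of length at least `m` begins with a path of length `m`. -/
theorem exists_comp_of_le_length {i j : V} (p : Path i j) {m : ℕ} (h : m ≤ p.length) :
    ∃ (k : V) (q : Path i k) (r : Path k j), q.length = m ∧ q.comp r = p := by
  induction p with
  | nil => exact ⟨i, .nil, .nil, by simp at h ⊢; omega, rfl⟩
  | cons p a ih =>
    rcases Nat.lt_or_ge p.length m with hlt | hle
    · exact ⟨_, p.cons a, .nil, by simp at h ⊢; omega, rfl⟩
    · obtain ⟨k, q, r, hq, rfl⟩ := ih hle
      exact ⟨k, q, r.cons a, hq, rfl⟩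

/-- The span of the long paths is already a two-sided ideal, and each long path has a prefix of
length exactly `m`. This turns ideal membership into a condition on coefficients. -/
theorem mem_arrowIdealPow_iff {m : ℕ} {x : PathAlgebra K V} :
    x ∈ arrowIdealPow K V m ↔ x ∈ lengthGE K V m := by
  constructor
  · intro h
    let I : TwoSidedIdeal (PathAlgebra K V) := TwoSidedIdeal.mk' (lengthGE K V m)
      (zero_mem _) (fun hx hy => add_mem hx hy) (fun hx => neg_mem hx)
      (fun {a b} hb => by
        have := mul_mem_lengthGE (K := K) (a := 0) (x := a) (by rw [lengthGE_zero]; trivial) hb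
        rwa [zero_add] at this)
      (fun {a b} ha => mul_mem_lengthGE (b := 0) (y := b) ha (by rw [lengthGE_zero]; trivial))
    have hI : arrowIdealPow K V m ≤ I := by
      refine TwoSidedIdeal.span_le.2 ?_
      rintro _ ⟨i, j, p, hp, rfl⟩
      exact (TwoSidedIdeal.mem_mk' _ _ _ _ _ _ _).2 (ofPath_mem_lengthGE p hp.ge)
    exact (TwoSidedIdeal.mem_mk' _ _ _ _ _ _ _).1 (hI h)
  · intro h
    rw [lengthGE] at h
    induction h using Submodule.span_induction with
    | mem x hx =>
      obtain ⟨⟨i, j, p⟩, hp, rfl⟩ := hx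
      obtain ⟨k, q, r, hq, rfl⟩ := exists_comp_of_le_length p hp
      rw [basis_apply, ← ofPath_mul_ofPath]
      exact TwoSidedIdeal.mul_mem_right _ _ _ (TwoSidedIdeal.subset_span ⟨i, k, q, hq, rfl⟩)
    | zero => exact zero_mem _
    | add x y _ _ hx hy => exact add_mem hx hy
    | smul c x _ hx =>
      rw [← one_mul x, ← smul_mul_assoc]
      exact TwoSidedIdeal.mul_mem_left _ _ _ hx

end PathAlgebra

/-! ### Truncated quiver algebras and their path bases -/

namespace TruncatedQuiverAlgebra

open PathAlgebra

universe u v w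

variable {K : Type w} [Field K] {V : Type u} [Quiver.{v} V] [Fintype V]

variable (K V) in
/-- The projection from `KΔ` onto `KΔ/R^m`. -/
def mk (m : ℕ) : PathAlgebra K V →ₐ[K] TruncatedQuiverAlgebra K V m :=
  RingCon.mkₐ K _

theorem mk_surjective (m : ℕ) : Function.Surjective (mk K V m) :=
  RingCon.mkₐ_surjective (α := K) _

theorem mk_eq_zero_iff {m : ℕ} {x : PathAlgebra K V} :
    mk K V m x = 0 ↔ x ∈ lengthGE K V m := by
  rw [← mem_arrowIdealPow_iff, TwoSidedIdeal.mem_iff]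
  exact RingCon.eq _

/-- The algebra map out of `KΔ/R^m` induced by a map killing all paths of length at least `m`. -/
def lift {T : Type*} [Ring T] [Algebra K T] {m : ℕ} (f : PathAlgebra K V →ₐ[K] T)
    (hf : ∀ x ∈ lengthGE K V m, f x = 0) : TruncatedQuiverAlgebra K V m →ₐ[K] T :=
  RingCon.liftₐ (arrowIdealPow K V m).ringCon f (fun x y h => by
    have := hf _ (mem_arrowIdealPow_iff.1 ((TwoSidedIdeal.rel_iff _ _ _).1 h))
    rw [map_sub, sub_eq_zero] at this
    exact this)

variable (K V) in
/-- The coordinates of `KΔ/R^m` with respect to the basis of paths of length less than `m`. -/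
def coordEquiv (m : ℕ) : TruncatedQuiverAlgebra K V m ≃ₗ[K]
    ({P : Σ i j : V, Path i j | P.2.2.length < m} →₀ K) := by
  let S : Set (Σ i j : V, Path i j) := {P | P.2.2.length < m}
  let g : PathAlgebra K V →ₗ[K] (S →₀ K) :=
    Finsupp.lsubtypeDomain S ∘ₗ (basis K V).repr.toLinearMap
  have hg : Function.Surjective g := by
    classical
    intro y
    refine ⟨(basis K V).repr.symm (y.extendDomain), ?_⟩
    simp [g, Finsupp.lsubtypeDomain_apply, S]
  have hker : LinearMap.ker (mk K V m).toLinearMap = LinearMap.ker g := by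
    ext x
    rw [LinearMap.mem_ker, LinearMap.mem_ker, AlgHom.toLinearMap_apply, mk_eq_zero_iff,
      mem_lengthGE_iff, Finsupp.ext_iff]
    exact ⟨fun h P => h P.1 P.2, fun h P hP => h ⟨P, hP⟩⟩
  exact ((mk K V m).toLinearMap.quotKerEquivOfSurjective (mk_surjective m)).symm.trans
    ((Submodule.quotEquivOfEq _ _ hker).trans (g.quotKerEquivOfSurjective hg))

end TruncatedQuiverAlgebra

/-! ### Paths in the cyclic quiver and the trace form -/

namespace CyclicQuiver

variable {s : ℕ}

/-- The residue of a vertex of the cyclic quiver. -/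
def residue (i : CyclicQuiver s) : ZMod s := i

theorem residue_injective : Function.Injective (residue : CyclicQuiver s → ZMod s) :=
  fun _ _ h => h

theorem residue_eq_of_hom {i j : CyclicQuiver s} (a : i ⟶ j) : residue j = residue i + 1 :=
  a.down.symm

theorem residue_eq_of_path {i j : CyclicQuiver s} (p : Path i j) :
    residue j = residue i + p.length := by
  induction p with
  | nil => simp
  | cons p a ih => rw [residue_eq_of_hom a, ih, Path.length_cons]; push_cast; ring

instance {i j : CyclicQuiver s} : Subsingleton (i ⟶ j) :=
  inferInstanceAs (Subsingleton (PLift (succ i = j)))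

/-- Every vertex has a unique predecessor and a unique arrow from it, so the last arrows agree and
can be removed. -/
theorem path_eq_of_length_eq {i j : CyclicQuiver s} (p q : Path i j)
    (h : p.length = q.length) : p = q := by
  induction p with
  | nil =>
    cases q with
    | nil => rfl
    | cons q b => simp at h
  | cons p a ih =>
    cases q with
    | nil => simp at h
    | cons q b =>
      have hab := residue_injective
        (add_right_cancel ((residue_eq_of_hom a).symm.trans (residue_eq_of_hom b)))
      subst hab
      rw [ih q (by simpa using h), Subsingleton.elim a b]

theorem path_ext_of_source {P Q : Σ i j : CyclicQuiver s, Path i j} (h₁ : P.1 = Q.1)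
    (h₂ : P.2.2.length = Q.2.2.length) : P = Q := by
  obtain ⟨i, j, p⟩ := P
  obtain ⟨i', j', q⟩ := Q
  obtain rfl : i = i' := h₁
  change p.length = q.length at h₂
  obtain rfl : j = j' := residue_injective (by
    rw [residue_eq_of_path p, residue_eq_of_path q, h₂])
  rw [path_eq_of_length_eq p q h₂]

theorem path_ext_of_target {P Q : Σ i j : CyclicQuiver s, Path i j} (h₁ : P.2.1 = Q.2.1)
    (h₂ : P.2.2.length = Q.2.2.length) : P = Q := by
  refine path_ext_of_source (residue_injective ?_) h₂
  have h := (residue_eq_of_path P.2.2).symm.trans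
    ((congrArg residue h₁).trans (residue_eq_of_path Q.2.2))
  rw [h₂] at h
  exact add_right_cancel h

theorem exists_path (i : CyclicQuiver s) (k : ℕ) :
    ∃ (j : CyclicQuiver s) (p : Path i j), p.length = k := by
  induction k with
  | zero => exact ⟨i, .nil, rfl⟩
  | succ k ih =>
    obtain ⟨j, p, hp⟩ := ih
    exact ⟨succ j, p.cons ⟨rfl⟩, by rw [Path.length_cons, hp]⟩

/-- The paths of length less than `m` correspond to pairs of a source and a length. -/
def pathEquiv (s m : ℕ) :
    {P : Σ i j : CyclicQuiver s, Path i j | P.2.2.length < m} ≃ ZMod s × Fin m :=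
  Equiv.ofBijective (fun P => (residue P.1.1, ⟨P.1.2.2.length, P.2⟩)) (by
    constructor
    · intro P Q h
      exact Subtype.ext (path_ext_of_source (congrArg Prod.fst h)
        (congrArg (fun x => x.2.val) h))
    · rintro ⟨i, k, hk⟩
      obtain ⟨j, p, hp⟩ := exists_path (s := s) i k
      subst hp
      exact ⟨⟨⟨i, j, p⟩, hk⟩, rfl⟩)

variable {K : Type*} [Field K] [NeZero s]

open PathAlgebra TruncatedQuiverAlgebra

instance (m : ℕ) : FiniteDimensional K (TruncatedQuiverAlgebra K (CyclicQuiver s) m) := by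
  have : Finite {P : Σ i j : CyclicQuiver s, Path i j | P.2.2.length < m} :=
    Finite.of_equiv _ (pathEquiv s m).symm
  exact Module.Finite.equiv (coordEquiv K (CyclicQuiver s) m).symm

theorem finrank_truncated (m : ℕ) :
    Module.finrank K (TruncatedQuiverAlgebra K (CyclicQuiver s) m) = s * m := by
  rw [((coordEquiv K (CyclicQuiver s) m).trans
    (Finsupp.domLCongr (pathEquiv s m))).finrank_eq, Module.finrank_finsupp_self]
  simp [ZMod.card]

variable (s K) in
/-- The functional on `KΔ` given by the sum of the coefficients of the paths of length `k`. -/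
def lengthForm (k : ℕ) : PathAlgebra K (CyclicQuiver s) →ₗ[K] K :=
  (basis K _).constr K fun P => if P.2.2.length = k then 1 else 0

theorem lengthForm_ofPath (k : ℕ) {i j : CyclicQuiver s} (p : Path i j) :
    lengthForm s K k (ofPath K p) = if p.length = k then 1 else 0 :=
  (basis K _).constr_basis K _ _

/-- Only pairs of paths of total length `k` matter. As `s` divides `k`, such a pair composes in one
order exactly when it composes in the other. -/
theorem lengthForm_mul_comm {k : ℕ} (hk : s ∣ k) (x y : PathAlgebra K (CyclicQuiver s)) :
    lengthForm s K k (x * y) = lengthForm s K k (y * x) := by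
  have h : (LinearMap.mul K (PathAlgebra K (CyclicQuiver s))).compr₂ (lengthForm s K k) =
      ((LinearMap.mul K (PathAlgebra K (CyclicQuiver s))).compr₂ (lengthForm s K k)).flip := by
    refine hom_ext fun i j p => hom_ext fun i' j' q => ?_
    simp only [LinearMap.compr₂_apply, LinearMap.mul_apply', LinearMap.flip_apply]
    by_cases hlen : p.length + q.length = k
    · have hres : residue j' - residue i = residue i' - residue j := by
        have hc : ((p.length : ZMod s) + q.length) = 0 := by
          rw [← Nat.cast_add, hlen]; exact (ZMod.natCast_eq_zero_iff k s).2 hk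
        rw [residue_eq_of_path p, residue_eq_of_path q]
        linear_combination hc
      by_cases hji : j = i'
      · subst hji
        obtain rfl : j' = i := residue_injective (sub_eq_zero.1 (by rw [hres, sub_self]))
        rw [ofPath_mul_ofPath, ofPath_mul_ofPath, lengthForm_ofPath, lengthForm_ofPath,
          Path.length_comp, Path.length_comp, add_comm]
      · have hji' : j' ≠ i := by
          rintro rfl
          exact hji (residue_injective (sub_eq_zero.1 (by rw [← hres, sub_self])).symm)
        rw [ofPath_mul_ofPath_of_ne _ _ hji, ofPath_mul_ofPath_of_ne _ _ hji']
    · have key : ∀ {a b c d : CyclicQuiver s} (p : Path a b) (q : Path c d),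
          p.length + q.length ≠ k → lengthForm s K k (ofPath K p * ofPath K q) = 0 := by
        intro a b c d p q hpq
        by_cases hbc : b = c
        · subst hbc
          rw [ofPath_mul_ofPath, lengthForm_ofPath, Path.length_comp, if_neg hpq]
        · rw [ofPath_mul_ofPath_of_ne _ _ hbc, map_zero]
      rw [key p q hlen, key q p (by omega)]
  exact LinearMap.congr_fun₂ h x y

/-- A path is determined by its target and length, so `p` is the only path that `q` extends to
length `k`. This makes the form nondegenerate below length `k + 1`. -/
theorem lengthForm_mul_ofPath {k : ℕ} (x : PathAlgebra K (CyclicQuiver s))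
    {i j l : CyclicQuiver s} (p : Path i j) (q : Path j l) (h : p.length + q.length = k) :
    lengthForm s K k (x * ofPath K q) = (basis K _).repr x ⟨i, j, p⟩ := by
  classical
  have h : lengthForm s K k ∘ₗ LinearMap.mulRight K (ofPath K q) =
      (basis K (CyclicQuiver s)).coord ⟨i, j, p⟩ := by
    refine (basis K _).ext fun ⟨i', j', p'⟩ => ?_
    rw [Module.Basis.coord_apply, Module.Basis.repr_self, Finsupp.single_apply]
    change lengthForm s K k (ofPath K p' * ofPath K q) = _
    by_cases hj : j' = j
    · subst hj
      rw [ofPath_mul_ofPath, lengthForm_ofPath, Path.length_comp]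
      refine if_congr ⟨fun hl => path_ext_of_target rfl ?_, fun hl => ?_⟩ rfl rfl
      · change p'.length = p.length
        omega
      · have := congrArg (fun P => P.2.2.length) hl
        change p'.length = p.length at this
        omega
    · rw [ofPath_mul_ofPath_of_ne _ _ hj, map_zero, if_neg]
      exact fun hl => hj (congrArg (fun P => P.2.1) hl)
  exact LinearMap.congr_fun h x

/-- The truncated cyclic quiver algebra is symmetric if the paths of maximal length are cycles. -/
theorem isSymmAlgebra_truncated {k : ℕ} (hk : s ∣ k) :
    IsSymmAlgebra K (TruncatedQuiverAlgebra K (CyclicQuiver s) (k + 1)) := by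
  -- The form descends to the quotient via a linear section; it kills longer paths, so the choice of
  -- section is immaterial.
  obtain ⟨σ, hσ⟩ := (mk K (CyclicQuiver s) (k + 1)).toLinearMap.exists_rightInverse_of_surjective
    (LinearMap.range_eq_top.2 (mk_surjective _))
  have hker : ∀ x ∈ lengthGE K (CyclicQuiver s) (k + 1), lengthForm s K k x = 0 := fun x hx =>
    lengthGE_le (M := LinearMap.ker (lengthForm s K k)) (fun i j p hp => by
      rw [LinearMap.mem_ker, lengthForm_ofPath, if_neg (by omega)]) hx
  set form := lengthForm s K k ∘ₗ σ with hform
  have form_mk : ∀ x, form (mk K _ (k + 1) x) = lengthForm s K k x := fun x => by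
    rw [← sub_eq_zero, hform, LinearMap.comp_apply, ← map_sub]
    refine hker _ (mk_eq_zero_iff.1 ?_)
    rw [map_sub, sub_eq_zero]
    exact LinearMap.congr_fun hσ (mk K _ (k + 1) x)
  have form_comm : ∀ a b, form (a * b) = form (b * a) := by
    intro a b
    obtain ⟨x, rfl⟩ := mk_surjective _ a
    obtain ⟨y, rfl⟩ := mk_surjective _ b
    rw [← map_mul, ← map_mul, form_mk, form_mk, lengthForm_mul_comm hk]
  let f : TruncatedQuiverAlgebra K (CyclicQuiver s) (k + 1) →ₗ[K] Module.Dual K _ :=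
    (LinearMap.mul K _).compr₂ form
  have f_apply : ∀ a b, f a b = form (a * b) := fun _ _ => rfl
  have hinj : Function.Injective f := by
    rw [injective_iff_map_eq_zero]
    intro a ha
    obtain ⟨x, rfl⟩ := mk_surjective _ a
    rw [mk_eq_zero_iff, mem_lengthGE_iff]
    rintro ⟨i, j, p⟩ hp
    change p.length < k + 1 at hp
    -- Completing `p` to length `k` reads off the coefficient of `p` in `x`.
    obtain ⟨l, q, hq⟩ := exists_path j (k - p.length)
    rw [← lengthForm_mul_ofPath x p q (k := k) (by omega), ← form_mk, map_mul, ← f_apply, ha,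
      LinearMap.zero_apply]
  refine ⟨LinearEquiv.ofInjectiveOfFinrankEq f hinj Subspace.dual_finrank_eq.symm, fun a x => ?_⟩
  constructor
  · refine LinearMap.ext fun y => ?_
    change form (a * x * y) = form (x * (y * a))
    rw [mul_assoc, form_comm, mul_assoc]
  · refine LinearMap.ext fun y => ?_
    change form (x * a * y) = form (x * (a * y))
    rw [mul_assoc]

end CyclicQuiver

theorem IsSymmAlgebra.of_algEquiv {K : Type*} [Field K] {A B : Type*} [Ring A] [Algebra K A]
    [Ring B] [Algebra K B] (e : A ≃ₐ[K] B) (h : IsSymmAlgebra K B) : IsSymmAlgebra K A := by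
  obtain ⟨f, hf⟩ := h
  refine ⟨e.toLinearEquiv.trans (f.trans e.toLinearEquiv.dualMap), fun a x => ?_⟩
  constructor <;> refine LinearMap.ext fun y => ?_
  · have := LinearMap.congr_fun (hf (e a) (e x)).1 (e y)
    simpa using this
  · have := LinearMap.congr_fun (hf (e a) (e x)).2 (e y)
    simpa using this

/-! ### Generation modulo the radical -/

section Radical

variable {K : Type*} [Field K] {T : Type*} [Ring T] [Algebra K T]

/-- Successive approximation: products of approximations modulo J² approximate elements of every
power of J one power better, and nilpotency ends the process. -/
theorem Subalgebra.eq_top_of_isNilpotent_ideal (S : Subalgebra K T) {J : Ideal T} [J.IsTwoSided]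
    (hJ : IsNilpotent J) (h₀ : ∀ t, ∃ x ∈ S, t - x ∈ J)
    (h₁ : ∀ t ∈ J, ∃ x ∈ S, t - x ∈ J * J) : S = ⊤ := by
  have step : ∀ k, ∀ t ∈ J ^ (k + 1), ∃ x ∈ S, t - x ∈ J ^ (k + 2) := by
    intro k
    induction k with
    | zero =>
      intro t ht
      rw [zero_add, Submodule.pow_one] at ht
      rw [Ideal.IsTwoSided.pow_succ, Submodule.pow_one]
      exact h₁ t ht
    | succ k ih =>
      intro t ht
      rw [Ideal.IsTwoSided.pow_succ] at ht
      induction ht using Submodule.mul_induction_on' with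
      | mem_mul_mem a ha b hb =>
        obtain ⟨x, hx, hax⟩ := h₁ a ha
        obtain ⟨y, hy, hby⟩ := ih b hb
        refine ⟨x * y, mul_mem hx hy, ?_⟩
        have hxJ : x ∈ J := by
          have := sub_mem ha (Ideal.mul_le_left hax)
          rwa [sub_sub_cancel] at this
        have h : a * b - x * y = (a - x) * b + x * (b - y) := by noncomm_ring
        rw [h]
        refine add_mem ?_ ?_
        · have := Ideal.mul_mem_mul hax hb
          have h2 : J * J = J ^ 2 := by rw [Ideal.IsTwoSided.pow_succ, Submodule.pow_one]
          rwa [h2, ← Ideal.IsTwoSided.pow_add, show 2 + (k + 1) = k + 1 + 2 by ring] at this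
        · have := Ideal.mul_mem_mul hxJ hby
          rwa [← Ideal.IsTwoSided.pow_succ] at this
      | add a _ b _ ha hb =>
        obtain ⟨x, hx, hax⟩ := ha
        obtain ⟨y, hy, hby⟩ := hb
        exact ⟨x + y, add_mem hx hy, by rw [add_sub_add_comm]; exact add_mem hax hby⟩
  have all : ∀ k t, ∃ x ∈ S, t - x ∈ J ^ (k + 1) := by
    intro k
    induction k with
    | zero => simpa only [zero_add, Submodule.pow_one] using h₀
    | succ k ih =>
      intro t
      obtain ⟨x, hx, htx⟩ := ih t
      obtain ⟨y, hy, hty⟩ := step k _ htx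
      exact ⟨x + y, add_mem hx hy, by rwa [← sub_sub]⟩
  obtain ⟨N, hN⟩ := hJ
  refine eq_top_iff.2 fun t _ => ?_
  obtain ⟨x, hx, htx⟩ := all N t
  have htx0 : t - x ∈ J ^ N := Ideal.pow_le_pow_right N.le_succ htx
  rw [hN, Submodule.zero_eq_bot, Submodule.mem_bot, sub_eq_zero] at htx0
  rwa [htx0]

theorem mem_corner {e f : T} {I : Ideal T} {x : T} :
    x ∈ corner K e f I ↔ ∃ u ∈ I, e * (u * f) = x := Iff.rfl

theorem mem_ring_jacobson_of_isNilpotent_mul {x : T} (h : ∀ y, IsNilpotent (y * x)) :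
    x ∈ Ring.jacobson T := by
  rw [← Ideal.jacobson_bot, Ideal.mem_jacobson_iff]
  intro y
  obtain ⟨u, hu⟩ := (h y).isUnit_add_one
  refine ⟨↑u⁻¹, ?_⟩
  rw [Submodule.mem_bot, sub_eq_zero]
  calc (↑u⁻¹ : T) * y * x + ↑u⁻¹ = ↑u⁻¹ * (y * x + 1) := by noncomm_ring
    _ = 1 := by rw [← hu, Units.inv_mul]

/-- Multiplying a linear relation by `f i` isolates its `i`-th coefficient, so the family is
independent, and its size is the dimension. -/
theorem span_range_eq_top_of_orthogonalIdempotents {V : Type*} [Fintype V] {f : V → V → K}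
    (hf : OrthogonalIdempotents f) (h : ∀ i, f i ≠ 0) : Submodule.span K (Set.range f) = ⊤ := by
  classical
  refine LinearIndependent.span_eq_top_of_card_eq_finrank' ?_ (by simp)
  rw [Fintype.linearIndependent_iff]
  intro c hc i
  have := congrArg (f i * ·) hc
  simp only [Finset.mul_sum, mul_zero, mul_smul_comm, hf.mul_eq] at this
  simpa [h i] using this

open PathAlgebra

/-- If the semisimple quotient of `T` is spanned by the idempotents `e i`, then `T` is a quotient
of the path algebra of its ordinary quiver. -/
theorem exists_surjective_algHom_of_ordinary {V : Type*} [Fintype V] [Quiver V] {e : V → T}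
    (he : CompleteOrthogonalIdempotents e) (hJ : IsNilpotent (Ring.jacobson T))
    (hb : ∀ i j : V, Nonempty (Module.Basis (i ⟶ j) K
      (corner K (e i) (e j) (Ring.jacobson T) ⧸
        (corner K (e i) (e j) (Ring.jacobson T * Ring.jacobson T)).submoduleOf
          (corner K (e i) (e j) (Ring.jacobson T)))))
    (h₀ : ∀ t : T, ∃ x ∈ Submodule.span K (Set.range e), t - x ∈ Ring.jacobson T) :
    ∃ φ : PathAlgebra K V →ₐ[K] T, Function.Surjective φ ∧
      ∀ x ∈ lengthGE K V 1, φ x ∈ Ring.jacobson T := by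
  set J := Ring.jacobson T
  let b := fun i j => (hb i j).some
  -- Each arrow goes to an arbitrary representative of its basis class.
  let Y : ∀ i j : V, (i ⟶ j) → corner K (e i) (e j) J := fun i j a => (b i j a).out
  let X : ∀ i j : V, (i ⟶ j) → T := fun i j a => Y i j a
  have hXJ : ∀ i j a, X i j a ∈ J := by
    intro i j a
    obtain ⟨u, hu, h⟩ := mem_corner.1 (Y i j a).2
    change (Y i j a : T) ∈ J
    rw [← h]
    exact J.mul_mem_left _ (J.mul_mem_right _ hu)
  have hr : ∀ i j a, X i j a * e j = X i j a := by
    intro i j a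
    obtain ⟨u, hu, h⟩ := mem_corner.1 (Y i j a).2
    change (Y i j a : T) * e j = Y i j a
    rw [← h, mul_assoc, mul_assoc, (he.idem j).eq]
  let φ := PathAlgebra.lift (K := K) he hr
  have hnil : ∀ i, φ (ofPath K (Quiver.Path.nil : Quiver.Path i i)) = e i := fun i => lift_ofPath he hr _
  have hl : ∀ i j a, e i * X i j a = X i j a := by
    intro i j a
    obtain ⟨u, hu, h⟩ := mem_corner.1 (Y i j a).2
    change e i * (Y i j a : T) = Y i j a
    rw [← h, ← mul_assoc, (he.idem i).eq]
  have harr : ∀ i j (a : i ⟶ j), φ (ofPath K a.toPath) = X i j a := fun i j a =>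
    (lift_ofPath he hr _).trans (hl i j a)
  have he_mem : ∀ i, e i ∈ φ.range := fun i => ⟨_, hnil i⟩
  refine ⟨φ, ?_, fun x hx => ?_⟩
  · rw [← AlgHom.range_eq_top]
    refine Subalgebra.eq_top_of_isNilpotent_ideal _ hJ (fun t => ?_) (fun t ht => ?_)
    · obtain ⟨x, hx, h⟩ := h₀ t
      refine ⟨x, ?_, h⟩
      have : Submodule.span K (Set.range e) ≤ Subalgebra.toSubmodule φ.range :=
        Submodule.span_le.2 (by rintro _ ⟨i, rfl⟩; exact he_mem i)
      exact this hx
    -- Approximate each Peirce component of `t` separately; their sum is `t`.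
    · have hij : ∀ i j, ∃ x ∈ φ.range, e i * (t * e j) - x ∈ J * J := by
        intro i j
        let N := (corner K (e i) (e j) (J * J)).submoduleOf (corner K (e i) (e j) J)
        have hq : ∀ q : corner K (e i) (e j) J ⧸ N,
            ∃ c : corner K (e i) (e j) J, N.mkQ c = q ∧ (c : T) ∈ φ.range := by
          intro q
          have hq := (b i j).mem_span q
          induction hq using Submodule.span_induction with
          | mem q hq =>
            obtain ⟨a, rfl⟩ := hq
            exact ⟨Y i j a, Quotient.out_eq _, ⟨_, harr i j a⟩⟩
          | zero => exact ⟨0, map_zero _, zero_mem _⟩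
          | add q r _ _ hq hr =>
            obtain ⟨c, rfl, hc⟩ := hq
            obtain ⟨d, rfl, hd⟩ := hr
            exact ⟨c + d, map_add _ _ _, add_mem hc hd⟩
          | smul k q _ hq =>
            obtain ⟨c, rfl, hc⟩ := hq
            exact ⟨k • c, map_smul _ _ _, Subalgebra.smul_mem _ hc k⟩
        obtain ⟨c, hc, hcS⟩ := hq (N.mkQ ⟨e i * (t * e j), t, ht, rfl⟩)
        refine ⟨c, hcS, ?_⟩
        obtain ⟨u, hu, h⟩ := mem_corner.1
          (show _ ∈ corner K (e i) (e j) (J * J) from (Submodule.Quotient.eq N).1 hc.symm)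
        change _ = e i * (t * e j) - (c : T) at h
        rw [← h]
        exact Ideal.mul_mem_left _ _ (Ideal.mul_mem_right _ _ hu)
      choose x hxS hx using hij
      refine ⟨∑ i, ∑ j, x i j, sum_mem fun i _ => sum_mem fun j _ => hxS i j, ?_⟩
      have ht' : t = ∑ i, ∑ j, e i * (t * e j) := by
        simp_rw [← Finset.mul_sum, ← Finset.sum_mul, he.complete, one_mul, mul_one]
      nth_rewrite 1 [ht']
      simp_rw [← Finset.sum_sub_distrib]
      exact sum_mem fun i _ => sum_mem fun j _ => hx i j
  · refine lengthGE_le (M := (J.restrictScalars K).comap φ.toLinearMap) (fun i j p hp => ?_) hx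
    cases p with
    | nil => simp at hp
    | cons p a =>
      change φ (ofPath K (p.comp a.toPath)) ∈ J
      rw [← ofPath_mul_ofPath, map_mul, harr]
      exact J.mul_mem_left _ (hXJ _ _ a)

end Radical

/-! ### The semisimple quotient of a truncated quiver algebra -/

namespace TruncatedQuiverAlgebra

open PathAlgebra

universe u v w

variable {K : Type w} [Field K] {V : Type u} [Quiver.{v} V] [Fintype V]

open Classical in
/-- The projection of the path algebra onto the span of the trivial paths. -/
def pathCounit (K : Type w) [Field K] (V : Type u) [Quiver.{v} V] [Fintype V] :
    PathAlgebra K V →ₐ[K] (V → K) :=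
  PathAlgebra.lift (X := fun _ _ _ => 0) (CompleteOrthogonalIdempotents.single fun _ : V => K)
    (fun _ _ _ => zero_mul _)

theorem pathCounit_ofPath_nil (i j : V) :
    pathCounit K V (ofPath K (Path.nil : Path i i)) j =
      (basis K V).repr (ofPath K (Path.nil : Path i i)) ⟨j, j, .nil⟩ := by
  classical
  rw [pathCounit, PathAlgebra.lift_ofPath, evalPath, ← basis_apply, Module.Basis.repr_self,
    Pi.single_apply, Finsupp.single_apply]
  refine if_congr ⟨?_, fun h => (congrArg Sigma.fst h).symm⟩ rfl rfl
  rintro rfl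
  rfl

theorem pathCounit_ofPath_of_pos {i j : V} (p : Path i j) (hp : 1 ≤ p.length) :
    pathCounit K V (ofPath K p) = 0 := by
  rw [pathCounit, PathAlgebra.lift_ofPath]
  cases p with
  | nil => simp at hp
  | cons p a => rw [evalPath, mul_zero]

theorem pathCounit_apply (x : PathAlgebra K V) (j : V) :
    pathCounit K V x j = (basis K V).repr x ⟨j, j, .nil⟩ := by
  have h : LinearMap.proj j ∘ₗ (pathCounit K V).toLinearMap = (basis K V).coord ⟨j, j, .nil⟩ := by
    refine hom_ext fun i k p => ?_
    cases p with
    | nil => exact pathCounit_ofPath_nil i j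
    | cons p a =>
      classical
      change pathCounit K V (ofPath K (p.cons a)) j = (basis K V).repr (ofPath K (p.cons a)) _
      rw [pathCounit_ofPath_of_pos _ (by simp), Pi.zero_apply, ← basis_apply,
        Module.Basis.repr_self, Finsupp.single_apply, if_neg]
      exact fun h => by simpa using congrArg (fun P => P.2.2.length) h
  exact LinearMap.congr_fun h x

theorem pathCounit_eq_zero_iff {x : PathAlgebra K V} :
    pathCounit K V x = 0 ↔ x ∈ lengthGE K V 1 := by
  rw [mem_lengthGE_iff]
  constructor
  · rintro h ⟨i, j, p⟩ hp
    cases p with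
    | nil => rw [← pathCounit_apply, h, Pi.zero_apply]
    | cons p a => simp at hp
  · intro h
    ext j
    rw [pathCounit_apply, h _ (by simp), Pi.zero_apply]

theorem pathCounit_surjective : Function.Surjective (pathCounit K V) := by
  classical
  intro c
  refine ⟨∑ i, c i • ofPath K (Path.nil : Path i i), ?_⟩
  rw [map_sum]
  ext j
  simp [pathCounit, PathAlgebra.lift_ofPath, evalPath, Finset.sum_apply, Pi.single_apply]

omit [Fintype V] in
theorem lengthGE_anti {a b : ℕ} (h : a ≤ b) : lengthGE K V b ≤ lengthGE K V a :=
  lengthGE_le fun _ _ p hp => ofPath_mem_lengthGE p (h.trans hp)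

theorem pow_mem_lengthGE {x : PathAlgebra K V} (hx : x ∈ lengthGE K V 1) (k : ℕ) :
    x ^ k ∈ lengthGE K V k := by
  induction k with
  | zero => rw [lengthGE_zero]; trivial
  | succ k ih => rw [pow_succ]; exact mul_mem_lengthGE ih hx

/-- The projection of `KΔ/R^m` onto the span of the trivial paths. -/
def counit {m : ℕ} (hm : 1 ≤ m) : TruncatedQuiverAlgebra K V m →ₐ[K] (V → K) :=
  lift (pathCounit K V) fun _ hx => pathCounit_eq_zero_iff.2 (lengthGE_anti hm hx)

theorem counit_surjective {m : ℕ} (hm : 1 ≤ m) :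
    Function.Surjective (counit (K := K) (V := V) hm) := fun c => by
  obtain ⟨x, hx⟩ := pathCounit_surjective c
  exact ⟨mk K V m x, hx⟩

theorem counit_mk {m : ℕ} (hm : 1 ≤ m) (x : PathAlgebra K V) :
    counit hm (mk K V m x) = pathCounit K V x := rfl

end TruncatedQuiverAlgebra

/-! ### Multiplication by elements of D(A) -/

namespace HochschildExtension

variable {K : Type*} [Field K] {A : Type*} [Ring A] [Algebra K A] (α : TwoCocycle K A)

/-- The projection of a Hochschild extension of `A` onto `A`. -/
def fstHom : HochschildExtension α →ₐ[K] A :=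
  AlgHom.ofLinearMap (LinearMap.fst K A (Module.Dual K A)) rfl fun _ _ => rfl

theorem fstHom_surjective : Function.Surjective (fstHom α) := fun a =>
  ⟨((a, 0) : A × Module.Dual K A), rfl⟩

variable {α}

theorem fstHom_apply (t : HochschildExtension α) : fstHom α t = t.1 := rfl

theorem mul_eq_zero_of_fst {t u : HochschildExtension α} (ht : t.1 = 0) (hu : u.1 = 0) :
    t * u = 0 := by
  ext <;> simp [ht, hu]

/-- The cocycle term vanishes with `t.1`. With its right-hand twin, this shows that `t * u` and `u *
t` determine the same value of the functional `t.2`. -/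
theorem mul_snd_of_left {t u : HochschildExtension α} (ht : t.1 = 0) :
    (t * u).2 1 = t.2 u.1 := by
  simp [ht]

theorem mul_snd_of_right {t u : HochschildExtension α} (ht : t.1 = 0) :
    (u * t).2 1 = t.2 u.1 := by
  simp [ht]

instance [FiniteDimensional K A] : FiniteDimensional K (HochschildExtension α) :=
  inferInstanceAs (FiniteDimensional K (A × Module.Dual K A))

theorem finrank_eq [FiniteDimensional K A] :
    Module.finrank K (HochschildExtension α) = 2 * Module.finrank K A := by
  change Module.finrank K (A × Module.Dual K A) = _
  rw [Module.finrank_prod, Subspace.dual_finrank_eq, two_mul]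

end HochschildExtension

/-! ### Extensions of truncated quiver algebras -/

namespace HochschildExtension

open PathAlgebra TruncatedQuiverAlgebra

section Quiver

universe u v w

variable {K : Type w} [Field K] {V : Type u} [Quiver.{v} V] [Fintype V] {n : ℕ}
  {α : TwoCocycle K (TruncatedQuiverAlgebra K V n)}

/-- The semisimple quotient of a Hochschild extension of `KΔ/R^n`. -/
def toSemisimple (hn : 1 ≤ n) (α : TwoCocycle K (TruncatedQuiverAlgebra K V n)) :
    HochschildExtension α →ₐ[K] (V → K) :=
  (counit hn).comp (fstHom α)

theorem toSemisimple_surjective (hn : 1 ≤ n) : Function.Surjective (toSemisimple hn α) :=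
  (counit_surjective hn).comp (fstHom_surjective α)

theorem toSemisimple_eq_zero_iff (hn : 1 ≤ n) {t : HochschildExtension α} :
    toSemisimple hn α t = 0 ↔ ∃ x ∈ lengthGE K V 1, mk K V n x = t.1 := by
  change counit hn t.1 = 0 ↔ _
  constructor
  · intro h
    obtain ⟨x, hx⟩ := mk_surjective n t.1
    rw [← hx, counit_mk, pathCounit_eq_zero_iff] at h
    exact ⟨x, h, hx⟩
  · rintro ⟨x, hx, h⟩
    rw [← h, counit_mk, pathCounit_eq_zero_iff.2 hx]

theorem isNilpotent_of_toSemisimple_eq_zero (hn : 1 ≤ n) {t : HochschildExtension α}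
    (ht : toSemisimple hn α t = 0) : IsNilpotent t := by
  obtain ⟨x, hx, h⟩ := (toSemisimple_eq_zero_iff hn).1 ht
  have htn : (t ^ n).1 = 0 := by
    rw [← fstHom_apply, map_pow, fstHom_apply, ← h, ← map_pow, mk_eq_zero_iff]
    exact pow_mem_lengthGE hx n
  exact ⟨n + n, by rw [pow_add, mul_eq_zero_of_fst htn htn]⟩

/-- A surjection sends the radical into that of K^V, which is zero; conversely the kernel is an
ideal of nilpotent elements. -/
theorem mem_jacobson_iff (hn : 1 ≤ n) {t : HochschildExtension α} :
    t ∈ Ring.jacobson (HochschildExtension α) ↔ toSemisimple hn α t = 0 := by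
  constructor
  · intro h
    have : RingHomSurjective (toSemisimple hn α).toRingHom := ⟨toSemisimple_surjective hn⟩
    have h' := Ring.le_comap_jacobson (toSemisimple hn α).toRingHom h
    rw [IsSemisimpleRing.jacobson_eq_bot] at h'
    exact h'
  · intro h
    refine mem_ring_jacobson_of_isNilpotent_mul fun y =>
      isNilpotent_of_toSemisimple_eq_zero hn ?_
    rw [map_mul, h, mul_zero]

variable [FiniteDimensional K (TruncatedQuiverAlgebra K V n)]

/-- If `T_α(KΔ/R^n)` has ordinary quiver `Δ`, then it is a quotient of `KΔ/R^{2n}`. -/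
theorem exists_surjective_of_isOrdinaryQuiver (hn : 1 ≤ n)
    (hα : IsOrdinaryQuiver K (HochschildExtension α) V) :
    ∃ φ : PathAlgebra K V →ₐ[K] HochschildExtension α, Function.Surjective φ ∧
      (∀ x ∈ lengthGE K V n, (φ x).1 = 0) ∧ ∀ x ∈ lengthGE K V (2 * n), φ x = 0 := by
  obtain ⟨e, he, hprim, -, hb⟩ := hα
  have : IsArtinianRing (HochschildExtension α) := IsArtinianRing.of_finite K _
  have hspan := span_range_eq_top_of_orthogonalIdempotents
    -- An `e i` with zero image would be a nilpotent idempotent, hence zero.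
    (he.toOrthogonalIdempotents.map (toSemisimple hn α).toRingHom) (fun i h =>
      (hprim i).2.1 (by
        obtain ⟨N, hN⟩ := isNilpotent_of_toSemisimple_eq_zero hn h
        rw [← (hprim i).1.pow_succ_eq N, pow_succ, hN, zero_mul]))
  obtain ⟨φ, hφ, hφJ⟩ := exists_surjective_algHom_of_ordinary he IsSemiprimaryRing.isNilpotent hb
    (fun t => by
      have ht : toSemisimple hn α t ∈
          (Submodule.span K (Set.range e)).map (toSemisimple hn α).toLinearMap := by
        rw [Submodule.map_span, ← Set.range_comp]
        exact hspan ▸ Submodule.mem_top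
      obtain ⟨x, hx, hxt⟩ := ht
      refine ⟨x, hx, (mem_jacobson_iff hn).2 ?_⟩
      rw [map_sub, sub_eq_zero]
      exact hxt.symm)
  -- The map to A need not send `p` to its own class, but it respects the length filtration, since
  -- arrows land in the radical.
  have hlen : ∀ (i j : V) (p : Quiver.Path i j),
      ∃ x ∈ lengthGE K V p.length, mk K V n x = (φ (ofPath K p)).1 := by
    intro i j p
    induction p with
    | nil =>
      obtain ⟨x, hx⟩ := mk_surjective n (φ (ofPath K (Quiver.Path.nil : Quiver.Path i i))).1
      exact ⟨x, by rw [Quiver.Path.length_nil, lengthGE_zero]; trivial, hx⟩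
    | cons p a ih =>
      obtain ⟨x, hx, h⟩ := ih
      obtain ⟨y, hy, h'⟩ := (toSemisimple_eq_zero_iff hn).1 ((mem_jacobson_iff hn).1
        (hφJ (ofPath K a.toPath) (ofPath_mem_lengthGE _ le_rfl)))
      refine ⟨x * y, mul_mem_lengthGE hx hy, ?_⟩
      change _ = (φ (ofPath K (p.comp a.toPath))).1
      rw [← ofPath_mul_ofPath, map_mul, map_mul, mul_fst, h, h']
  have hfst : ∀ x ∈ lengthGE K V n, (φ x).1 = 0 := fun x hx =>
    lengthGE_le (M := LinearMap.ker ((fstHom α).comp φ).toLinearMap) (fun i j p hp => by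
      obtain ⟨y, hy, h⟩ := hlen i j p
      change (φ (ofPath K p)).1 = 0
      rw [← h, mk_eq_zero_iff]
      exact lengthGE_anti hp hy) hx
  refine ⟨φ, hφ, hfst, fun x hx => lengthGE_le (M := LinearMap.ker φ.toLinearMap)
    (fun i j p hp => ?_) hx⟩
  obtain ⟨k, q, r, hq, rfl⟩ := exists_comp_of_le_length p (m := n) (by omega)
  rw [Quiver.Path.length_comp] at hp
  change φ (ofPath K (q.comp r)) = 0
  rw [← ofPath_mul_ofPath, map_mul]
  exact mul_eq_zero_of_fst (hfst _ (ofPath_mem_lengthGE q hq.ge))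
    (hfst _ (ofPath_mem_lengthGE r (by omega)))

omit [FiniteDimensional K (TruncatedQuiverAlgebra K V n)] in
/-- A nonzero path in the top degree of `T_α(KΔ/R^n)` is a cycle. -/
theorem eq_of_ofPath_ne_zero {φ : PathAlgebra K V →ₐ[K] HochschildExtension α}
    (hφ : Function.Surjective φ) {m : ℕ} (hm : ∀ x ∈ lengthGE K V (m + 1), φ x = 0)
    {i j : V} (p : Quiver.Path i j) (hp : p.length = m) (hfst : (φ (ofPath K p)).1 = 0)
    (hne : φ (ofPath K p) ≠ 0) : i = j := by
  by_contra hij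
  refine hne (HochschildExtension.ext hfst fun a => ?_)
  obtain ⟨t, rfl⟩ := fstHom_surjective α a
  obtain ⟨x, rfl⟩ := hφ t
  -- Test the functional on a path `q`: if `q` does not run from `j` to `i`, then pq or qp is 0; if
  -- it does, it has positive length because `i ≠ j`, so pq is longer than `m`.
  have h : (φ (ofPath K p)).2 ∘ₗ ((fstHom α).comp φ).toLinearMap = 0 := by
    refine hom_ext fun k l q => ?_
    change (φ (ofPath K p)).2 (φ (ofPath K q)).1 = 0
    by_cases hjk : j = k
    · by_cases hli : l = i
      · have hq : 1 ≤ q.length := by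
          rw [Nat.one_le_iff_ne_zero]
          intro hq
          exact hij (hjk.trans ((Quiver.Path.eq_of_length_zero q hq).trans hli)).symm
        subst hjk
        rw [← mul_snd_of_left hfst, ← map_mul, ofPath_mul_ofPath,
          hm _ (ofPath_mem_lengthGE _ (by rw [Quiver.Path.length_comp]; omega))]
        rfl
      · rw [← mul_snd_of_right hfst, ← map_mul, ofPath_mul_ofPath_of_ne _ _ hli, map_zero]
        rfl
    · rw [← mul_snd_of_left hfst, ← map_mul, ofPath_mul_ofPath_of_ne _ _ hjk, map_zero]
      rfl
  exact LinearMap.congr_fun h x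

end Quiver

end HochschildExtension

end

/-! ### The main theorem -/

open PathAlgebra TruncatedQuiverAlgebra HochschildExtension CyclicQuiver in
theorem corollary4p5 {K : Type*} [Field K] (s n : ℕ) [NeZero s] (hn : 2 ≤ n)
    (α : TwoCocycle K (TruncatedQuiverAlgebra K (CyclicQuiver s) n))
    (hα : IsOrdinaryQuiver K (HochschildExtension α) (CyclicQuiver s)) :
    Nonempty (HochschildExtension α ≃ₐ[K] TruncatedQuiverAlgebra K (CyclicQuiver s) (2 * n)) ∧
      IsSymmAlgebra K (HochschildExtension α) := by
  obtain ⟨φ, hφ, hfst, hker⟩ := exists_surjective_of_isOrdinaryQuiver (by omega) hα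
  have hsurj : Function.Surjective (TruncatedQuiverAlgebra.lift φ hker) := fun t => by
    obtain ⟨x, rfl⟩ := hφ t
    exact ⟨mk K _ _ x, rfl⟩
  have hdim : Module.finrank K (TruncatedQuiverAlgebra K (CyclicQuiver s) (2 * n)) =
      Module.finrank K (HochschildExtension α) := by
    rw [HochschildExtension.finrank_eq, finrank_truncated, finrank_truncated]
    ring
  have hinj : Function.Injective (TruncatedQuiverAlgebra.lift φ hker) :=
    (LinearMap.injective_iff_surjective_of_finrank_eq_finrank hdim
      (f := (TruncatedQuiverAlgebra.lift φ hker).toLinearMap)).2 hsurj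
  let E := AlgEquiv.ofBijective _ ⟨hinj, hsurj⟩
  refine ⟨⟨E.symm⟩, IsSymmAlgebra.of_algEquiv E.symm ?_⟩
  -- Then 2n = (2m + 1) + 1, so the longest surviving paths have length 2m + 1.
  obtain ⟨m, rfl⟩ : ∃ m, n = m + 1 := ⟨n - 1, by omega⟩
  refine isSymmAlgebra_truncated (k := 2 * m + 1) ?_
  obtain ⟨i⟩ : Nonempty (CyclicQuiver s) := ⟨(0 : ZMod s)⟩
  obtain ⟨j, p, hp⟩ := exists_path i (2 * m + 1)
  have hne : φ (ofPath K p) ≠ 0 := by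
    intro h
    have hmk : mk K (CyclicQuiver s) (2 * (m + 1)) (ofPath K p) = 0 :=
      hinj (h.trans (map_zero _).symm)
    have := mem_lengthGE_iff.1 (mk_eq_zero_iff.1 hmk) ⟨_, j, p⟩ (by change p.length < _; omega)
    rw [← basis_apply, Module.Basis.repr_self, Finsupp.single_eq_same] at this
    exact one_ne_zero this
  obtain rfl := eq_of_ofPath_ne_zero hφ (m := 2 * m + 1) hker p hp
    (hfst _ (ofPath_mem_lengthGE p (by omega))) hne
  -- The path is now a cycle, so its length is zero modulo `s`.
  have hres := residue_eq_of_path p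
  rw [left_eq_add, hp] at hres
  exact (ZMod.natCast_eq_zero_iff _ _).1 hres
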